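/- Let $N\ge 1$ be an integer. Consider the generalized Laguerre ensemble with $\gamma_1N=N$, $\gamma_2N=N+1$, that is, $N$ eigenvalues $\lambda_1,\dots,\lambda_N\ge 0$ with joint density proportional to $$\Delta^2(\lambda)\prod_{i=1}^N \lambda_i\,e^{-N\lambda_i},\qquad \Delta(\lambda)=\prod_{i<j}(\lambda_i-\lambda_j)$$ (so that the exponent of each $\lambda_i$ is $(\gamma_2-\gamma_1)N=1$). Let $$W_1(x)=\frac1N\cdot\frac1{\mathcal Z}\int_{[0,\infty)^N}\Delta^2(\lambda)\prod_{i=1}^N\lambda_i e^{-N\lambda_i}\,\sum_{i=1}^N\frac1{x-\lambda_i}\;d\lambda_1\cdots d\lambda_N ,\qquad x\in\mathbb C\setminus[0,\infty),$$ be the one-loop mean, where $\mathcal Z=\int_{[0,\infty)^N}\Delta^2(\lambda)\prod_i\lambda_ie^{-N\lambda_i}\,d\lambda$. Then $0<\mathcal Z<\infty$, the integral defining $W_1(x)$ converges absolutely for every $x\in\mathbb C\setminus[0,\infty)$, the function $W_1$ is holomorphic on $\mathbb C\setminus[0,\infty)$, and there it satisfies the inhomogeneous fourth-order linear differential equation $$\begin{aligned}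 \Bigl[\,&N^2\Bigl((-2x^2+8x)\frac{\partial}{\partial x}+4\Bigr)+N\Bigl((-x^2+8x)\frac{\partial}{\partial x}+4\Bigr)\\ &+\Bigl(2x^2\frac{\partial^3}{\partial x^3}+(-x^2+12x)\frac{\partial^2}{\partial x^2}+(-x+12)\frac{\partial}{\partial x}+1\Bigr)\\ &+N^{-1}\Bigl(x^2\frac{\partial^3}{\partial x^3}+6x\frac{\partial^2}{\partial x^2}+6\frac{\partial}{\partial x}\Bigr) +N^{-2}\Bigl(x^2\frac{\partial^4}{\partial x^4}+7x\frac{\partial^3}{\partial x^3}+9\frac{\partial^2}{\partial x^2}\Bigr)\Bigr]W_1(x) =2N^2+N+\frac{2N+2}{x}. \end{aligned}$$ -/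

import Mathlib

open MeasureTheory

noncomputable section

namespace LaguerreLoop

/-- The Vandermonde product `∏_{i<j} (l i - l j)`. -/
def vandermondeProd {N : ℕ} (l : Fin N → ℝ) : ℝ :=
  ∏ i : Fin N, ∏ j ∈ Finset.Ioi i, (l i - l j)

/-- The unnormalized joint eigenvalue density `Δ(l)² ∏_i l_i ^ k e^{-N l_i}` of the generalized
Laguerre ensemble of `N × N` nonnegative Hermitian matrices with the matrix weight
`(det H) ^ k e^{-N tr H}`. It is used only on the orthant `l ≥ 0`. In terms of rectangular
`N × (N + k)` complex matrices, the exponent is `k = (γ₂ - γ₁) N`, with `γ₁ N = N` and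
`γ₂ N = N + k`. -/
def eigenDensity (k N : ℕ) (l : Fin N → ℝ) : ℝ :=
  vandermondeProd l ^ 2 * ∏ i : Fin N, (l i ^ k * Real.exp (-(N : ℝ) * l i))

/-- The orthant `[0, ∞)^N`. -/
def orthant (N : ℕ) : Set (Fin N → ℝ) := {l | ∀ i, 0 ≤ l i}

/-- The partition function. -/
def partitionFn (k N : ℕ) : ℝ := ∫ l in orthant N, eigenDensity k N l

/-- The density times `tr (x - H)⁻¹ = ∑_i 1 / (x - l_i)`. -/
def resolventIntegrand (k N : ℕ) (x : ℂ) (l : Fin N → ℝ) : ℂ :=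
  (eigenDensity k N l : ℂ) * ∑ i : Fin N, 1 / (x - (l i : ℂ))

/-- The one-loop mean `W₁(x) = ⟨ (1/N) tr (x - H)⁻¹ ⟩`, which behaves as `1 / x` at infinity. -/
def oneLoopMean (k N : ℕ) (x : ℂ) : ℂ :=
  (1 / (N : ℂ)) * ((1 / (partitionFn k N : ℂ)) * ∫ l in orthant N, resolventIntegrand k N x l)

/-- The complex plane without the half-line `[0, ∞)` that carries the eigenvalues. -/
def offCut : Set ℂ := {x | ∀ r : ℝ, 0 ≤ r → x ≠ (r : ℂ)}

end LaguerreLoop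

end

/-!
The multiplication-then-derivative operator `F ↦ (t F)'` has no boundary term at `0`, so it commutes
with the Stieltjes transform. Hence a linear differential equation for the one-point density turns
into one for `W₁`, and multiplication by `t` only contributes the mass and the mean of the density
as inhomogeneous terms.

The Vandermonde determinant may be written in monic Laguerre polynomials `p₀, …, p_{N-1}`, and
orthogonality reduces Andréief's identity to the statement that the one-point density is
proportional to `∑ p_j² / h_j` times the weight, `h_j` being the squared norm of `p_j`. By the
confluent Christoffel–Darboux formula this sum is a multiple of the Wronskian of `p_{N-1}` and
`p_N`, and the Sturm–Liouville form of the Laguerre equation shows that `(t f)'` is a multiple of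
`p_{N-1} p_N` times the weight if `f` is the density. The ladder relations keep the span of
`p_{N-1}²`, `p_{N-1} p_N` and `p_N²`, with polynomial coefficients, stable under `F ↦ (t F)'`, and
eliminating the squares gives a third-order equation for the density, for every exponent of the
weight. For exponent `1`, applying `N⁻² ∂ + 2 + N⁻¹` to the equation of `W₁` produces a multiple of
`x`, and dividing by `x` leaves the fourth-order equation.
-/

open Polynomial Set Filter Topology

namespace LaguerreLoop

section LaguerrePolynomials

variable {R : Type*} [CommRing R]

/-- The monic Laguerre polynomials with parameter `α` and scale `a`, given by their three-term
recurrence. For real `α > -1` and `a > 0` they are the monic orthogonal polynomials of the weight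
`t ^ α e^{-t/a}` on `[0, ∞)`; the definition makes sense over any commutative ring. -/
noncomputable def monicLaguerre (α a : R) : ℕ → R[X]
  | 0 => 1
  | 1 => X - C ((α + 1) * a)
  | j + 2 => (X - C ((2 * j + 3 + α) * a)) * monicLaguerre α a (j + 1)
      - C ((j + 1) * (j + 1 + α) * a ^ 2) * monicLaguerre α a j

variable (α a : R)

theorem monicLaguerre_zero : monicLaguerre α a 0 = 1 := by rw [monicLaguerre]

theorem monicLaguerre_one : monicLaguerre α a 1 = X - C ((α + 1) * a) := by rw [monicLaguerre]

theorem monicLaguerre_add_two (j : ℕ) :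
    monicLaguerre α a (j + 2) = (X - C ((2 * j + 3 + α) * a)) * monicLaguerre α a (j + 1)
      - C ((j + 1) * (j + 1 + α) * a ^ 2) * monicLaguerre α a j := by
  rw [monicLaguerre]

theorem isMonicOfDegree_monicLaguerre [Nontrivial R] (j : ℕ) :
    IsMonicOfDegree (monicLaguerre α a j) j := by
  induction j using Nat.twoStepInduction with
  | zero => simp [monicLaguerre_zero]
  | one => simpa [monicLaguerre_one] using isMonicOfDegree_X_sub_one ((α + 1) * a)
  | more j ih ih' =>
    rw [monicLaguerre_add_two, show j + 2 = 1 + (j + 1) by ring]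
    refine ((isMonicOfDegree_X_sub_one _).mul ih').sub ?_
    exact (natDegree_C_mul_le _ _).trans_lt (by rw [ih.natDegree_eq]; omega)

theorem monicLaguerre_ladder (j : ℕ) :
    X * derivative (monicLaguerre α a (j + 1)) =
        C (j + 1 : R) * monicLaguerre α a (j + 1)
          + C ((j + 1) * (j + 1 + α) * a) * monicLaguerre α a j ∧
      C a * (X * derivative (monicLaguerre α a j)) =
        (X - C ((j + 1 + α) * a)) * monicLaguerre α a j - monicLaguerre α a (j + 1) := by
  induction j with
  | zero =>
    rw [zero_add, monicLaguerre_zero, monicLaguerre_one, derivative_X_sub_C, derivative_one]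
    simp only [Nat.cast_zero, C_mul, C_add, C_1, C_0]
    constructor <;> ring
  | succ j ih =>
    obtain ⟨hlower, hraise⟩ := ih
    have hrec := monicLaguerre_add_two α a j
    have hder := congrArg derivative hrec
    simp only [derivative_sub, derivative_mul, derivative_X, derivative_C] at hder
    push_cast
    simp only [C_mul, C_add, C_pow, map_natCast, map_ofNat, map_one] at hlower hraise hrec hder ⊢
    constructor
    · linear_combination X * hder + (X - (2 * (j : R[X]) + 3 + C α) * C a) * hlower
        - ((j : R[X]) + 1) * ((j : R[X]) + 1 + C α) * C a * hraise - ((j : R[X]) + 2) * hrec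
    · linear_combination C a * hlower + hrec

theorem X_mul_derivative_monicLaguerre_succ (j : ℕ) :
    X * derivative (monicLaguerre α a (j + 1)) =
      C (j + 1 : R) * monicLaguerre α a (j + 1)
        + C ((j + 1) * (j + 1 + α) * a) * monicLaguerre α a j :=
  (monicLaguerre_ladder α a j).1

theorem C_mul_X_mul_derivative_monicLaguerre (j : ℕ) :
    C a * (X * derivative (monicLaguerre α a j)) =
      (X - C ((j + 1 + α) * a)) * monicLaguerre α a j - monicLaguerre α a (j + 1) :=
  (monicLaguerre_ladder α a j).2

theorem derivative_monicLaguerre_succ (j : ℕ) :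
    derivative (monicLaguerre α a (j + 1)) =
      C (j + 1 : R) * (monicLaguerre α a j - C a * derivative (monicLaguerre α a j)) := by
  have hlower := X_mul_derivative_monicLaguerre_succ α a j
  have hraise := C_mul_X_mul_derivative_monicLaguerre α a j
  refine isRegular_X.left ?_
  simp only [C_mul] at hlower hraise ⊢
  linear_combination hlower + C (j + 1 : R) * hraise

theorem monicLaguerre_differential_equation (j : ℕ) :
    C a * (X * derivative (derivative (monicLaguerre α a j))
        + C (α + 1) * derivative (monicLaguerre α a j))
      = X * derivative (monicLaguerre α a j) - C (j : R) * monicLaguerre α a j := by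
  have hraise := congrArg derivative (C_mul_X_mul_derivative_monicLaguerre α a j)
  have hder := derivative_monicLaguerre_succ α a j
  simp only [derivative_sub, derivative_mul, derivative_X, derivative_C] at hraise
  simp only [C_mul, C_add, C_1] at hraise hder ⊢
  linear_combination hraise - hder

/-- The squared norm of `monicLaguerre k a j` for the weight `t ^ k e^{-t/a}` on `[0, ∞)`. -/
def laguerreNormSq (k : ℕ) (a : R) (j : ℕ) : R :=
  j.factorial * (j + k).factorial * a ^ (2 * j + k + 1)

theorem laguerreNormSq_succ (k : ℕ) (a : R) (j : ℕ) :
    laguerreNormSq k a (j + 1) = (j + 1) * (j + 1 + k) * a ^ 2 * laguerreNormSq k a j := by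
  simp only [laguerreNormSq, show j + 1 + k = j + k + 1 by ring, Nat.factorial_succ]
  push_cast
  ring

theorem laguerreNormSq_ne_zero {K : Type*} [Field K] [CharZero K] (k : ℕ) {a : K} (ha : a ≠ 0)
    (j : ℕ) : laguerreNormSq k a j ≠ 0 := by
  simp [laguerreNormSq, ha, Nat.factorial_ne_zero]

end LaguerrePolynomials

section ChristoffelDarboux

theorem sum_sq_eq_wronskian_of_three_term_recurrence {K : Type*} [Field K] {p : ℕ → K[X]}
    {b c h : ℕ → K} (hp0 : p 0 = 1) (hp1 : p 1 = X - C (b 0))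
    (hp : ∀ j, p (j + 2) = (X - C (b (j + 1))) * p (j + 1) - C (c j) * p j)
    (hh : ∀ j, h (j + 1) = c j * h j) (hne : ∀ j, h j ≠ 0) (m : ℕ) :
    ∑ j ∈ Finset.range (m + 1), (h j)⁻¹ • (p j * p j)
      = (h m)⁻¹ • wronskian (p m) (p (m + 1)) := by
  induction m with
  | zero => simp [wronskian, hp0, hp1]
  | succ m ih =>
    have hc : c m ≠ 0 := fun hc => hne (m + 1) (by rw [hh, hc, zero_mul])
    have hinv : C (h m)⁻¹ = C (h (m + 1))⁻¹ * C (c m) := by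
      rw [← C_mul, hh, mul_inv_rev, inv_mul_cancel_right₀ hc]
    rw [Finset.sum_range_succ, ih, hp]
    simp only [smul_eq_C_mul, hinv, wronskian, derivative_sub, derivative_mul, derivative_X,
      derivative_C]
    ring

end ChristoffelDarboux

section TwistedDerivative

variable {R : Type*} [CommRing R]

/-- The derivative transported to polynomials through `f ↦ f e^{-n t}`: the derivative of
`f e^{-n t}` is `(twistedDeriv n f) e^{-n t}`. -/
noncomputable def twistedDeriv (n : R) : R[X] →ₗ[R] R[X] := derivative - n • LinearMap.id

/-- The operator `g ↦ (t g)' = g + t g'` transported to polynomials through `f ↦ f e^{-n t}`. -/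
noncomputable def twistedEuler (n : R) : R[X] →ₗ[R] R[X] :=
  twistedDeriv n ∘ₗ LinearMap.mulLeft R X

theorem twistedDeriv_apply (n : R) (f : R[X]) : twistedDeriv n f = derivative f - C n * f := by
  simp [twistedDeriv, smul_eq_C_mul]

theorem twistedEuler_apply (n : R) (f : R[X]) : twistedEuler n f = twistedDeriv n (X * f) := rfl

theorem twistedDeriv_X_pow_succ_mul (n : R) (k : ℕ) (f : R[X]) :
    twistedDeriv n (X ^ (k + 1) * f) =
      X ^ k * ((C (k + 1 : R) - C n * X) * f + X * derivative f) := by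
  rw [twistedDeriv_apply, derivative_mul, derivative_X_pow_succ]
  ring

theorem twistedEuler_X_pow_mul (n : R) (k : ℕ) (f : R[X]) :
    twistedEuler n (X ^ k * f) =
      X ^ k * ((C (k + 1 : R) - C n * X) * f + X * derivative f) := by
  rw [twistedEuler_apply, ← mul_assoc, ← pow_succ', twistedDeriv_X_pow_succ_mul]

section Laguerre

variable {n a : R} (hna : n * a = 1) (k : ℕ)

local notation "ℒ" => monicLaguerre (k : R) a

include hna

theorem X_mul_derivative_monicLaguerre (α : R) (j : ℕ) :
    X * derivative (monicLaguerre α a j) =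
      (C n * X - C (j + 1 + α)) * monicLaguerre α a j - C n * monicLaguerre α a (j + 1) := by
  have hC : C n * C a = 1 := by rw [← C_mul, hna, C_1]
  have hraise := C_mul_X_mul_derivative_monicLaguerre α a j
  rw [C_mul] at hraise
  linear_combination C n * hraise
    - (X * derivative (monicLaguerre α a j) + C (j + 1 + α) * monicLaguerre α a j) * hC

theorem twistedDeriv_wronskian_monicLaguerre (i j : ℕ) :
    twistedDeriv n (X ^ (k + 1) * wronskian (ℒ i) (ℒ j))
      = (n * (i - j)) • (X ^ k * (ℒ i * ℒ j)) := by
  have hC : C n * C a = 1 := by rw [← C_mul, hna, C_1]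
  have hi := monicLaguerre_differential_equation (k : R) a i
  have hj := monicLaguerre_differential_equation (k : R) a j
  rw [twistedDeriv_X_pow_succ_mul]
  simp only [wronskian, derivative_sub, derivative_mul, smul_eq_C_mul, C_mul, C_sub]
  set u := ℒ i
  set v := ℒ j
  linear_combination C n * X ^ k * (u * hj - v * hi)
    - X ^ k * (u * (X * derivative (derivative v) + C (k + 1 : R) * derivative v)
        - v * (X * derivative (derivative u) + C (k + 1 : R) * derivative u)) * hC

theorem twistedEuler_monicLaguerre_mul_succ (m : ℕ) :
    twistedEuler n (X ^ k * (ℒ m * ℒ (m + 1)))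
      = X ^ k * (ℒ m * ℒ (m + 1) + C ((m + 1) * (m + 1 + k) * a) * (ℒ m * ℒ m)
        - C n * (ℒ (m + 1) * ℒ (m + 1))) := by
  have hu := X_mul_derivative_monicLaguerre hna (k : R) m
  have hv := X_mul_derivative_monicLaguerre_succ (k : R) a m
  rw [twistedEuler_X_pow_mul, derivative_mul]
  simp only [C_add, C_1] at hu hv ⊢
  linear_combination X ^ k * (ℒ (m + 1) * hu + ℒ m * hv)

theorem twistedEuler_twistedEuler_monicLaguerre_mul_succ (m : ℕ) :
    twistedEuler n (twistedEuler n (X ^ k * (ℒ m * ℒ (m + 1))))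
      = X ^ k * (C (1 - 4 * (m + 1) * (m + 1 + k) : R) * (ℒ m * ℒ (m + 1))
        + C ((m + 1) * (m + 1 + k) * a) * (C n * X - C (2 * m + k : R)) * (ℒ m * ℒ m)
        - C n * (C (2 * m + 4 + k : R) - C n * X) * (ℒ (m + 1) * ℒ (m + 1))) := by
  have hC : C n * C a = 1 := by rw [← C_mul, hna, C_1]
  have hu := X_mul_derivative_monicLaguerre hna (k : R) m
  have hv := X_mul_derivative_monicLaguerre_succ (k : R) a m
  rw [twistedEuler_monicLaguerre_mul_succ hna, twistedEuler_X_pow_mul]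
  set u := ℒ m
  set v := ℒ (m + 1)
  simp only [derivative_sub, derivative_mul, derivative_C, derivative_add]
  simp only [C_mul, C_add, C_sub, map_natCast, map_ofNat, map_one] at hu hv ⊢
  linear_combination X ^ k * (v + 2 * ((m : R[X]) + 1) * ((m : R[X]) + 1 + k) * C a * u) * hu
    + X ^ k * (u - 2 * C n * v) * hv
    - 4 * ((m : R[X]) + 1) * ((m : R[X]) + 1 + k) * X ^ k * u * v * hC

theorem twistedEuler_wronskian_monicLaguerre (m : ℕ) :
    twistedEuler n (X ^ k * wronskian (ℒ m) (ℒ (m + 1)))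
      = -n • (X ^ k * (ℒ m * ℒ (m + 1))) := by
  rw [twistedEuler_apply, ← mul_assoc, ← pow_succ', twistedDeriv_wronskian_monicLaguerre hna]
  push_cast
  ring_nf

theorem X_mul_wronskian_monicLaguerre (m : ℕ) :
    X * (X ^ k * wronskian (ℒ m) (ℒ (m + 1)))
      = X ^ k * (C ((m + 1) * (m + 1 + k) * a) * (ℒ m * ℒ m)
        + C (2 * (m + 1) + k : R) * (ℒ m * ℒ (m + 1)) + C n * (ℒ (m + 1) * ℒ (m + 1)))
        - C n * (X * (X ^ k * (ℒ m * ℒ (m + 1)))) := by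
  have hu := X_mul_derivative_monicLaguerre hna (k : R) m
  have hv := X_mul_derivative_monicLaguerre_succ (k : R) a m
  simp only [wronskian, C_mul, C_add, map_natCast, map_ofNat, map_one] at hu hv ⊢
  linear_combination X ^ k * (ℒ m * hv - ℒ (m + 1) * hu)

/-- `f e^{-n t}` is a multiple of the one-point density of the Laguerre ensemble with `m + 1`
particles. -/
theorem wronskian_monicLaguerre_differential_equation (m : ℕ) {f : R[X]}
    (hf : f = X ^ k * wronskian (ℒ m) (ℒ (m + 1))) :
    twistedEuler n (twistedEuler n (twistedEuler n f))
      - (2 : R) • twistedEuler n (twistedEuler n f)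
      + (1 - (k : R) ^ 2) • twistedEuler n f
      + (n * (2 * (m + 1) + k)) • (X * ((2 : R) • twistedEuler n f - f))
      - n ^ 2 • (X * (X * (twistedEuler n f - f))) = 0 := by
  have hEf := twistedEuler_wronskian_monicLaguerre hna k m
  have hXf := X_mul_wronskian_monicLaguerre hna k m
  rw [← hf] at hEf hXf
  rw [hEf, map_smul, map_smul, twistedEuler_twistedEuler_monicLaguerre_mul_succ hna,
    twistedEuler_monicLaguerre_mul_succ hna]
  simp only [smul_eq_C_mul, C_mul, C_neg, C_add, C_sub, C_pow, map_natCast, map_ofNat, map_one]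
    at hXf ⊢
  linear_combination C n * (C n * X - (2 * ((m : R[X]) + 1) + k)) * hXf

end Laguerre

end TwistedDerivative

section ExponentialMoments

/-- The function `f e^{-n t}` of the real variable `t`. -/
noncomputable def expWeighted (n : ℂ) : ℂ[X] →ₗ[ℂ] ℝ → ℂ where
  toFun f t := f.eval (t : ℂ) * Complex.exp (-n * t)
  map_add' f g := by ext t; simp [add_mul]
  map_smul' c f := by ext t; simp [mul_assoc]

theorem expWeighted_apply (n : ℂ) (f : ℂ[X]) (t : ℝ) :
    expWeighted n f t = f.eval (t : ℂ) * Complex.exp (-n * t) := rfl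

theorem expWeighted_X_mul (n : ℂ) (f : ℂ[X]) :
    expWeighted n (X * f) = fun t => t * expWeighted n f t := by
  ext t
  simp [expWeighted_apply, mul_assoc]

theorem hasDerivAt_expWeighted (n : ℂ) (f : ℂ[X]) (t : ℝ) :
    HasDerivAt (expWeighted n f) (expWeighted n (twistedDeriv n f) t) t := by
  have h := ((f.hasDerivAt (t : ℂ)).mul ((hasDerivAt_const_mul (-n)).cexp)).comp_ofReal
  refine h.congr_deriv ?_
  simp only [twistedDeriv_apply, expWeighted_apply, eval_sub, eval_mul, eval_C]
  ring

variable {n : ℂ} (hn : 0 < n.re)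
include hn

theorem integrableOn_expWeighted (f : ℂ[X]) : IntegrableOn (expWeighted n f) (Ioi 0) := by
  induction f using Polynomial.induction_on' with
  | add f g hf hg => exact map_add (expWeighted n) f g ▸ hf.add hg
  | monomial j c =>
    have hreal := integrableOn_rpow_mul_exp_neg_mul_rpow (s := j) (p := 1)
      (neg_one_lt_zero.trans_le j.cast_nonneg) one_pos hn
    refine Integrable.mono' (hreal.const_mul ‖c‖) ?_ ?_
    · exact Continuous.aestronglyMeasurable (by
        simp only [funext (expWeighted_apply n _)]; fun_prop)
    · filter_upwards [ae_restrict_mem measurableSet_Ioi] with t (ht : 0 < t)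
      simp [expWeighted_apply, Complex.norm_exp, abs_of_pos ht, mul_assoc]

/-- The moment functional `f ↦ ∫ f e^{-n t}` of the exponential weight on `[0, ∞)`. -/
noncomputable def expMoment : ℂ[X] →ₗ[ℂ] ℂ where
  toFun f := ∫ t in Ioi (0 : ℝ), expWeighted n f t
  map_add' f g := by
    simp only [map_add, Pi.add_apply]
    exact integral_add (integrableOn_expWeighted hn f) (integrableOn_expWeighted hn g)
  map_smul' c f := by
    simp only [map_smul, Pi.smul_apply]
    exact integral_smul c _

theorem expMoment_apply (f : ℂ[X]) : expMoment hn f = ∫ t in Ioi (0 : ℝ), expWeighted n f t := rfl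

theorem expMoment_twistedDeriv (f : ℂ[X]) : expMoment hn (twistedDeriv n f) = -f.eval 0 := by
  have hderiv := hasDerivAt_expWeighted n f
  have hint := integrableOn_expWeighted hn (twistedDeriv n f)
  have hlim := tendsto_zero_of_hasDerivAt_of_integrableOn_Ioi (fun t _ => hderiv t) hint
    (integrableOn_expWeighted hn f)
  rw [expMoment_apply, integral_Ioi_of_hasDerivAt_of_tendsto' (fun t _ => hderiv t) hint hlim]
  simp [expWeighted_apply]

theorem expMoment_twistedEuler (f : ℂ[X]) : expMoment hn (twistedEuler n f) = 0 := by
  simp [twistedEuler_apply, expMoment_twistedDeriv]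

theorem expMoment_X_mul_twistedEuler (f : ℂ[X]) :
    expMoment hn (X * twistedEuler n f) = -expMoment hn (X * f) := by
  have hleibniz : X * twistedEuler n f = twistedEuler n (X * f) - X * f := by
    simp only [twistedEuler_apply, twistedDeriv_apply, derivative_mul, derivative_X]
    ring
  rw [hleibniz, map_sub, expMoment_twistedEuler, zero_sub]

end ExponentialMoments

section LaguerreMoments

variable {n a : ℂ} (hn : 0 < n.re) (hna : n * a = 1) (k : ℕ)

local notation "ℒ" => monicLaguerre (k : ℂ) a

include hna

theorem expMoment_X_pow : expMoment hn (X ^ k) = k.factorial * a ^ (k + 1) := by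
  induction k with
  | zero =>
    have h := expMoment_twistedDeriv hn 1
    rw [twistedDeriv_apply, derivative_one, zero_sub, ← smul_eq_C_mul, map_neg, map_smul,
      smul_eq_mul, eval_one] at h
    simp only [pow_zero, Nat.factorial_zero, Nat.cast_one, zero_add, pow_one]
    linear_combination -a * h - expMoment hn 1 * hna
  | succ j ih =>
    have hpoly : twistedDeriv n (X ^ (j + 1)) = (j + 1 : ℂ) • X ^ j - n • X ^ (j + 1) := by
      rw [twistedDeriv_apply, derivative_X_pow_succ, smul_eq_C_mul, smul_eq_C_mul]
    have h := expMoment_twistedDeriv hn (X ^ (j + 1))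
    simp only [hpoly, map_sub, map_smul, smul_eq_mul, ih, eval_pow, eval_X] at h
    rw [Nat.factorial_succ]
    push_cast
    linear_combination -a * h - expMoment hn (X ^ (j + 1)) * hna

theorem expMoment_monicLaguerre_mul_of_ne {i j : ℕ} (hij : i ≠ j) :
    expMoment hn (X ^ k * (ℒ i * ℒ j)) = 0 := by
  have h := expMoment_twistedDeriv hn (X ^ (k + 1) * wronskian (ℒ i) (ℒ j))
  rw [twistedDeriv_wronskian_monicLaguerre hna, map_smul, smul_eq_mul] at h
  have hn0 : n ≠ 0 := left_ne_zero_of_mul_eq_one hna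
  have hij' : (i : ℂ) - j ≠ 0 := sub_ne_zero.mpr (Nat.cast_injective.ne hij)
  simpa [hn0, hij'] using h

theorem expMoment_monicLaguerre_mul_self (j : ℕ) :
    expMoment hn (X ^ k * (ℒ j * ℒ j)) = laguerreNormSq k a j := by
  induction j with
  | zero => simp [monicLaguerre_zero, laguerreNormSq, expMoment_X_pow hn hna]
  | succ j ih =>
    have h := expMoment_twistedEuler hn (X ^ k * (ℒ j * ℒ (j + 1)))
    rw [twistedEuler_monicLaguerre_mul_succ hna] at h
    simp only [← smul_eq_C_mul, mul_add, mul_sub, mul_smul_comm, map_add, map_sub, map_smul,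
      smul_eq_mul, ih, expMoment_monicLaguerre_mul_of_ne hn hna k j.lt_succ_self.ne] at h
    rw [laguerreNormSq_succ]
    linear_combination -a * h - expMoment hn (X ^ k * (ℒ (j + 1) * ℒ (j + 1))) * hna

theorem expMoment_monicLaguerre_mul (i j : ℕ) :
    expMoment hn (X ^ k * (ℒ i * ℒ j)) = if i = j then laguerreNormSq k a i else 0 := by
  split_ifs with h
  · rw [← h, expMoment_monicLaguerre_mul_self hn hna]
  · exact expMoment_monicLaguerre_mul_of_ne hn hna k h

theorem expMoment_X_mul_wronskian_monicLaguerre (m : ℕ) :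
    expMoment hn (X * (X ^ k * wronskian (ℒ m) (ℒ (m + 1))))
      = (m + 1) * (m + 1 + k) * a * laguerreNormSq k a m := by
  have hE := expMoment_X_mul_twistedEuler hn (X ^ k * wronskian (ℒ m) (ℒ (m + 1)))
  have hX := congrArg (expMoment hn) (X_mul_wronskian_monicLaguerre hna k m)
  rw [twistedEuler_wronskian_monicLaguerre hna, mul_smul_comm] at hE
  simp only [← smul_eq_C_mul, mul_add (X ^ k), mul_smul_comm, LinearMap.map_add, map_sub, map_smul,
    smul_eq_mul, expMoment_monicLaguerre_mul hn hna, if_true, m.lt_succ_self.ne, if_false] at hE hX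
  rw [laguerreNormSq_succ] at hX
  linear_combination (1 / 2) * hX + (1 / 2) * hE
    + (1 / 2) * (m + 1) * (m + 1 + k) * a * laguerreNormSq k a m * hna

end LaguerreMoments

section DensityPolynomial

/-- The polynomial `f` for which `f e^{-n t}` is the normalized one-point density of the Laguerre
ensemble of `N` particles with the weight `t ^ k e^{-n t}`. -/
noncomputable def densityPoly {K : Type*} [Field K] (k : ℕ) (n : K) (N : ℕ) : K[X] :=
  (N : K)⁻¹ • (X ^ k * ∑ j ∈ Finset.range N, (laguerreNormSq k n⁻¹ j)⁻¹ •
    (monicLaguerre (k : K) n⁻¹ j * monicLaguerre (k : K) n⁻¹ j))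

theorem densityPoly_succ {K : Type*} [Field K] [CharZero K] (k : ℕ) {n : K} (hn : n ≠ 0) (m : ℕ) :
    densityPoly k n (m + 1) = ((m + 1 : K)⁻¹ * (laguerreNormSq k n⁻¹ m)⁻¹) • (X ^ k *
      wronskian (monicLaguerre (k : K) n⁻¹ m) (monicLaguerre (k : K) n⁻¹ (m + 1))) := by
  have hcd := sum_sq_eq_wronskian_of_three_term_recurrence
    (p := monicLaguerre (k : K) n⁻¹) (h := laguerreNormSq k n⁻¹)
    (b := fun j => (2 * j + 1 + k) * n⁻¹) (c := fun j => (j + 1) * (j + 1 + k) * n⁻¹ ^ 2)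
    (monicLaguerre_zero _ _) (by rw [monicLaguerre_one]; push_cast; ring_nf)
    (fun j => by rw [monicLaguerre_add_two]; push_cast; ring_nf)
    (laguerreNormSq_succ k n⁻¹) (laguerreNormSq_ne_zero k (inv_ne_zero hn)) m
  rw [densityPoly, hcd, mul_smul_comm, smul_smul, Nat.cast_succ]

theorem densityPoly_differential_equation {K : Type*} [Field K] [CharZero K] (k : ℕ) {n : K}
    (hn : n ≠ 0) (N : ℕ) :
    twistedEuler n (twistedEuler n (twistedEuler n (densityPoly k n N)))
      - (2 : K) • twistedEuler n (twistedEuler n (densityPoly k n N))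
      + (1 - (k : K) ^ 2) • twistedEuler n (densityPoly k n N)
      + (n * (2 * N + k)) • (X * ((2 : K) • twistedEuler n (densityPoly k n N) - densityPoly k n N))
      - n ^ 2 • (X * (X * (twistedEuler n (densityPoly k n N) - densityPoly k n N))) = 0 := by
  cases N with
  | zero => simp [densityPoly]
  | succ m =>
    have h := wronskian_monicLaguerre_differential_equation (mul_inv_cancel₀ hn) k m rfl
    rw [densityPoly_succ k hn]
    set c := (m + 1 : K)⁻¹ * (laguerreNormSq k n⁻¹ m)⁻¹
    simp only [map_smul, smul_comm _ c, ← smul_sub, ← smul_add, mul_smul_comm, Nat.cast_succ]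
    rw [h, smul_zero]

variable {n : ℂ} (hn : 0 < n.re) (k : ℕ) {N : ℕ} (hN : N ≠ 0)
include hN

theorem expMoment_densityPoly : expMoment hn (densityPoly k n N) = 1 := by
  have hn0 : n ≠ 0 := fun h => by simp [h] at hn
  have hnorm := laguerreNormSq_ne_zero k (inv_ne_zero hn0)
  simp only [densityPoly, Finset.mul_sum, mul_smul_comm, map_smul, map_sum, smul_eq_mul,
    expMoment_monicLaguerre_mul_self hn (mul_inv_cancel₀ hn0), inv_mul_cancel₀ (hnorm _)]
  simp [hN]

theorem expMoment_X_mul_densityPoly : expMoment hn (X * densityPoly k n N) = (N + k) / n := by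
  have hn0 : n ≠ 0 := fun h => by simp [h] at hn
  obtain ⟨m, rfl⟩ := Nat.exists_eq_succ_of_ne_zero hN
  have hnorm := laguerreNormSq_ne_zero k (inv_ne_zero hn0) m
  have hm : (m + 1 : ℂ) ≠ 0 := m.cast_add_one_ne_zero
  rw [densityPoly_succ k hn0, mul_smul_comm, map_smul, smul_eq_mul,
    expMoment_X_mul_wronskian_monicLaguerre hn (mul_inv_cancel₀ hn0)]
  generalize laguerreNormSq k n⁻¹ m = h at hnorm ⊢
  push_cast
  field_simp

end DensityPolynomial

section StieltjesTransform

theorem isOpen_offCut : IsOpen offCut := by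
  have hcompl : offCut = (Complex.ofReal '' Ici 0)ᶜ := by
    ext x
    simp only [offCut, mem_ofPred_eq, mem_compl_iff, mem_image, mem_Ici, not_exists, not_and]
    exact forall₂_congr fun r _ => ne_comm
  rw [hcompl, isOpen_compl_iff]
  exact Complex.isometry_ofReal.isClosedEmbedding.isClosedMap _ isClosed_Ici

theorem sub_ofReal_ne_zero {x : ℂ} (hx : x ∈ offCut) {t : ℝ} (ht : 0 ≤ t) : x - (t : ℂ) ≠ 0 :=
  sub_ne_zero.mpr (hx t ht)

theorem exists_ball_le_norm_sub {x : ℂ} (hx : x ∈ offCut) :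
    ∃ ε > 0, ∀ y ∈ Metric.ball x ε, ∀ t : ℝ, 0 ≤ t → ε ≤ ‖y - t‖ := by
  obtain ⟨δ, hδ, hball⟩ := Metric.isOpen_iff.mp isOpen_offCut x hx
  refine ⟨δ / 2, half_pos hδ, fun y hy t ht => ?_⟩
  by_contra! hlt
  refine hball (?_ : (t : ℂ) ∈ Metric.ball x δ) t ht rfl
  rw [Metric.mem_ball] at hy ⊢
  rw [← dist_eq_norm, dist_comm] at hlt
  linarith [dist_triangle (t : ℂ) y x]

theorem exists_norm_inv_sub_le {x : ℂ} (hx : x ∈ offCut) :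
    ∃ B, ∀ t : ℝ, 0 ≤ t → ‖(x - t)⁻¹‖ ≤ B := by
  obtain ⟨ε, hε, hball⟩ := exists_ball_le_norm_sub hx
  refine ⟨ε⁻¹, fun t ht => ?_⟩
  rw [norm_inv]
  exact inv_anti₀ hε (hball x (Metric.mem_ball_self hε) t ht)

/-- The Stieltjes transform `x ↦ ∫ F(t) / (x - t) dt` of a function on `[0, ∞)`. -/
noncomputable def stieltjes (F : ℝ → ℂ) (x : ℂ) : ℂ := ∫ t in Ioi (0 : ℝ), F t * (x - t)⁻¹

variable {F F' : ℝ → ℂ} {x : ℂ}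

theorem integrableOn_mul_inv_sub (hF : IntegrableOn F (Ioi 0)) (hx : x ∈ offCut) :
    IntegrableOn (fun t => F t * (x - t)⁻¹) (Ioi 0) := by
  obtain ⟨B, hB⟩ := exists_norm_inv_sub_le hx
  refine hF.mul_bdd (c := B) (Measurable.aestronglyMeasurable (by fun_prop)) ?_
  filter_upwards [ae_restrict_mem measurableSet_Ioi] with t ht using hB t (le_of_lt ht)

theorem stieltjes_id_mul (hF : IntegrableOn F (Ioi 0)) (hx : x ∈ offCut) :
    stieltjes (fun t => t * F t) x = x * stieltjes F x - ∫ t in Ioi (0 : ℝ), F t := by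
  unfold stieltjes
  rw [← integral_const_mul, ← integral_sub ((integrableOn_mul_inv_sub hF hx).const_mul x) hF]
  refine setIntegral_congr_fun measurableSet_Ioi fun t ht => ?_
  have := sub_ofReal_ne_zero hx (le_of_lt ht)
  field_simp
  ring

theorem hasDerivAt_stieltjes_kernel (hF : IntegrableOn F (Ioi 0)) (hx : x ∈ offCut) :
    IntegrableOn (fun t => F t * (-1 / (x - t) ^ 2)) (Ioi 0) ∧
      HasDerivAt (stieltjes F) (∫ t in Ioi (0 : ℝ), F t * (-1 / (x - t) ^ 2)) x := by
  obtain ⟨ε, hε, hball⟩ := exists_ball_le_norm_sub hx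
  have hmeas {g : ℝ → ℂ} (hg : Measurable g) :
      AEStronglyMeasurable (fun t => F t * g t) (volume.restrict (Ioi 0)) :=
    hF.aestronglyMeasurable.mul hg.aestronglyMeasurable
  refine hasDerivAt_integral_of_dominated_loc_of_deriv_le (bound := fun t => ‖F t‖ * (1 / ε ^ 2))
    (F := fun (y : ℂ) (t : ℝ) => F t * (y - t)⁻¹)
    (F' := fun (y : ℂ) (t : ℝ) => F t * (-1 / (y - t) ^ 2))
    (Metric.ball_mem_nhds x hε) (.of_forall fun y => hmeas (by fun_prop))
    (integrableOn_mul_inv_sub hF hx) (hmeas (by fun_prop)) ?_ (hF.norm.mul_const _) ?_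
  · filter_upwards [ae_restrict_mem measurableSet_Ioi] with t ht y hy
    rw [norm_mul, norm_div, norm_neg, norm_one, norm_pow]
    have := hball y hy t (le_of_lt ht)
    gcongr
  · filter_upwards [ae_restrict_mem measurableSet_Ioi] with t ht y hy
    have hy0 : y - (t : ℂ) ≠ 0 := norm_pos_iff.mp (hε.trans_le (hball y hy t (le_of_lt ht)))
    exact (((hasDerivAt_id y).sub_const (t : ℂ)).inv hy0).const_mul (F t)

theorem differentiableOn_stieltjes (hF : IntegrableOn F (Ioi 0)) :
    DifferentiableOn ℂ (stieltjes F) offCut := fun _ hx =>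
  (hasDerivAt_stieltjes_kernel hF hx).2.differentiableAt.differentiableWithinAt

theorem hasDerivAt_stieltjes (hF : IntegrableOn F (Ioi 0)) (hF' : IntegrableOn F' (Ioi 0))
    (hderiv : ∀ t, 0 ≤ t → HasDerivAt F (F' t) t) (hF0 : F 0 = 0) (hx : x ∈ offCut) :
    HasDerivAt (stieltjes F) (stieltjes F' x) x := by
  obtain ⟨hkernel, hS⟩ := hasDerivAt_stieltjes_kernel hF hx
  have hS' := integrableOn_mul_inv_sub hF' hx
  have hprod : ∀ t : ℝ, 0 ≤ t → HasDerivAt (fun t => F t * (x - t)⁻¹)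
      (F' t * (x - t)⁻¹ - F t * (-1 / (x - t) ^ 2)) t := fun t ht => by
    refine ((hderiv t ht).mul (((hasDerivAt_id t).ofReal_comp.const_sub x).inv
      (sub_ofReal_ne_zero hx ht))).congr_deriv ?_
    simp only [Complex.ofReal_one, id, Pi.inv_apply]
    ring
  have hlim := tendsto_zero_of_hasDerivAt_of_integrableOn_Ioi (fun t ht => hprod t (le_of_lt ht))
    (hS'.sub hkernel) (integrableOn_mul_inv_sub hF hx)
  have hparts := integral_Ioi_of_hasDerivAt_of_tendsto' hprod (hS'.sub hkernel) hlim
  rw [integral_sub hS' hkernel, hF0, zero_mul, sub_zero] at hparts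
  exact hS.congr_deriv (sub_eq_zero.mp hparts).symm

theorem hasDerivAt_mul_stieltjes (hF : IntegrableOn F (Ioi 0))
    (hG : IntegrableOn (fun t => t * F t) (Ioi 0)) (hF' : IntegrableOn F' (Ioi 0))
    (hderiv : ∀ t, 0 ≤ t → HasDerivAt (fun t => t * F t) (F' t) t) (hx : x ∈ offCut) :
    HasDerivAt (fun y => y * stieltjes F y) (stieltjes F' x) x := by
  have hS := (hasDerivAt_stieltjes hG hF' hderiv (by simp) hx).add_const
    (∫ t in Ioi (0 : ℝ), F t)
  refine hS.congr_of_eventuallyEq ?_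
  filter_upwards [isOpen_offCut.mem_nhds hx] with y hy
  simp [stieltjes_id_mul hF hy]

end StieltjesTransform

section ExponentialStieltjes

variable {n : ℂ} (hn : 0 < n.re) {x : ℂ} (hx : x ∈ offCut)

/-- The linear functional sending `f` to the value at `x` of the Stieltjes transform of
`f e^{-n t}`. -/
noncomputable def expStieltjes : ℂ[X] →ₗ[ℂ] ℂ where
  toFun f := stieltjes (expWeighted n f) x
  map_add' f g := by
    simp only [stieltjes, map_add, Pi.add_apply, add_mul]
    exact integral_add (integrableOn_mul_inv_sub (integrableOn_expWeighted hn f) hx)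
      (integrableOn_mul_inv_sub (integrableOn_expWeighted hn g) hx)
  map_smul' c f := by
    simp only [stieltjes, map_smul, Pi.smul_apply, smul_mul_assoc]
    exact integral_smul c _

theorem expStieltjes_apply (f : ℂ[X]) :
    expStieltjes hn hx f = stieltjes (expWeighted n f) x := rfl

theorem expStieltjes_X_mul (f : ℂ[X]) :
    expStieltjes hn hx (X * f) = x * expStieltjes hn hx f - expMoment hn f := by
  rw [expStieltjes_apply, expWeighted_X_mul]
  exact stieltjes_id_mul (integrableOn_expWeighted hn f) hx

include hn hx in
theorem hasDerivAt_mul_stieltjes_expWeighted (f : ℂ[X]) :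
    HasDerivAt (fun y => y * stieltjes (expWeighted n f) y)
      (stieltjes (expWeighted n (twistedEuler n f)) x) x := by
  refine hasDerivAt_mul_stieltjes (integrableOn_expWeighted hn f) ?_
    (integrableOn_expWeighted hn (twistedEuler n f)) (fun t _ => ?_) hx
  · exact expWeighted_X_mul n f ▸ integrableOn_expWeighted hn (X * f)
  · exact expWeighted_X_mul n f ▸ hasDerivAt_expWeighted n (X * f) t

theorem expStieltjes_densityPoly_equation (k : ℕ) {N : ℕ} (hN : N ≠ 0) {f : ℂ[X]}
    (hf : f = densityPoly k n N) :
    expStieltjes hn hx (twistedEuler n (twistedEuler n (twistedEuler n f)))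
      - 2 * expStieltjes hn hx (twistedEuler n (twistedEuler n f))
      + (1 - (k : ℂ) ^ 2) * expStieltjes hn hx (twistedEuler n f)
      + n * (2 * N + k) * (x * (2 * expStieltjes hn hx (twistedEuler n f) - expStieltjes hn hx f))
      - n ^ 2 * (x ^ 2 * (expStieltjes hn hx (twistedEuler n f) - expStieltjes hn hx f))
    = n ^ 2 * x + n * k := by
  have hn0 : n ≠ 0 := fun h => by simp [h] at hn
  have hode := congrArg (expStieltjes hn hx) (densityPoly_differential_equation k hn0 N)
  have hmean : n * expMoment hn (X * f) = N + k := by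
    rw [hf, expMoment_X_mul_densityPoly hn k hN, mul_div_cancel₀ _ hn0]
  have hmass : expMoment hn f = 1 := by rw [hf, expMoment_densityPoly hn k hN]
  rw [← hf] at hode
  simp only [map_add, map_sub, map_smul, map_zero, smul_eq_mul, expStieltjes_X_mul, mul_sub X,
    mul_smul_comm, expMoment_twistedEuler, expMoment_X_mul_twistedEuler, hmass] at hode
  linear_combination hode + 2 * n * hmean

end ExponentialStieltjes

section EulerOperator

variable {s : Set ℂ} (hs : IsOpen s) {g : ℂ → ℂ}
include hs

theorem hasDerivAt_iteratedDeriv (hg : DifferentiableOn ℂ g s) (m : ℕ) {x : ℂ} (hx : x ∈ s) :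
    HasDerivAt (iteratedDeriv m g) (iteratedDeriv (m + 1) g x) x := by
  rw [iteratedDeriv_succ]
  have hanalytic := (hg.analyticAt (hs.mem_nhds hx)).iterated_deriv m
  rw [← iteratedDeriv_eq_iterate] at hanalytic
  exact hanalytic.differentiableAt.hasDerivAt

/-- The coefficients are those of `(1 + x ∂) ^ m` for `m ≤ 3`. -/
theorem eqOn_iterate_hasDerivAt_mul (hg : DifferentiableOn ℂ g s) {g₁ g₂ g₃ : ℂ → ℂ}
    (h₁ : ∀ x ∈ s, HasDerivAt (fun y => y * g y) (g₁ x) x)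
    (h₂ : ∀ x ∈ s, HasDerivAt (fun y => y * g₁ y) (g₂ x) x)
    (h₃ : ∀ x ∈ s, HasDerivAt (fun y => y * g₂ y) (g₃ x) x) :
    EqOn g₁ (fun x => g x + x * iteratedDeriv 1 g x) s ∧
      EqOn g₂ (fun x => g x + 3 * x * iteratedDeriv 1 g x + x ^ 2 * iteratedDeriv 2 g x) s ∧
      EqOn g₃ (fun x => g x + 7 * x * iteratedDeriv 1 g x + 6 * x ^ 2 * iteratedDeriv 2 g x
        + x ^ 3 * iteratedDeriv 3 g x) s := by
  have hD (m : ℕ) {x : ℂ} (hx : x ∈ s) := hasDerivAt_iteratedDeriv hs hg m hx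
  have hnext {u v u' v' : ℂ → ℂ} (hu : ∀ x ∈ s, HasDerivAt (fun y => y * u y) (v x) x)
      (huv : EqOn u u' s) (hv' : ∀ x ∈ s, HasDerivAt (fun y => y * u' y) (v' x) x) :
      EqOn v v' s := fun x hx => by
    refine (hu x hx).unique ((hv' x hx).congr_of_eventuallyEq ?_)
    filter_upwards [hs.mem_nhds hx] with y hy using by rw [huv hy]
  have h0 {x : ℂ} (hx : x ∈ s) : HasDerivAt g (iteratedDeriv 1 g x) x := by
    simpa only [iteratedDeriv_zero] using hD 0 hx
  have e₁ : EqOn g₁ (fun x => g x + x * iteratedDeriv 1 g x) s :=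
    hnext h₁ (fun _ _ => rfl) fun x hx =>
      ((hasDerivAt_id x).mul (h0 hx)).congr_deriv (by simp)
  have e₂ := hnext h₂ e₁ (v' := fun x => g x + 3 * x * iteratedDeriv 1 g x
      + x ^ 2 * iteratedDeriv 2 g x) fun x hx =>
    ((hasDerivAt_id x).mul ((h0 hx).add ((hasDerivAt_id x).mul (hD 1 hx)))).congr_deriv
      (by simp only [id_eq, Pi.add_apply, Pi.mul_apply]; ring)
  refine ⟨e₁, e₂, hnext h₃ e₂ fun x hx => ?_⟩
  refine ((hasDerivAt_id x).mul (((h0 hx).add (((hasDerivAt_id x).const_mul 3).mul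
    (hD 1 hx))).add (((hasDerivAt_id x).pow 2).mul (hD 2 hx)))).congr_deriv ?_
  simp only [id_eq, Pi.add_apply, Pi.mul_apply, Pi.pow_apply]
  ring

end EulerOperator

section DeterminantalIntegrals

theorem exists_ne_and_perm_apply_ne {ι : Type*} {σ τ : Equiv.Perm ι} (h : σ ≠ τ) (m : ι) :
    ∃ i, i ≠ m ∧ σ i ≠ τ i := by
  obtain ⟨i, hi⟩ := not_forall.mp (mt Equiv.ext h)
  rcases eq_or_ne i m with rfl | him
  · have hj : τ.symm (σ i) ≠ i := fun hj => hi ((Equiv.symm_apply_eq τ).mp hj)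
    exact ⟨τ.symm (σ i), hj, by rw [Equiv.apply_symm_apply]; exact σ.injective.ne hj⟩
  · exact ⟨i, him, hi⟩

variable {ι X 𝕜 : Type*} [Fintype ι] [DecidableEq ι] [MeasurableSpace X] [RCLike 𝕜]
  {ν : Measure X} [SigmaFinite ν]

/-- Andréief's identity, before the sum over one of the two permutations is evaluated: the factors
`c i` may depend on the variable. -/
theorem integral_det_mul_det_mul_prod {φ ψ c : ι → X → 𝕜}
    (hint : ∀ i j m, Integrable (fun t => φ i t * ψ j t * c m t) ν) :
    Integrable (fun l : ι → X => (Matrix.of fun i j => φ j (l i)).det *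
        (Matrix.of fun i j => ψ j (l i)).det * ∏ i, c i (l i)) (Measure.pi fun _ => ν) ∧
      ∫ l : ι → X, (Matrix.of fun i j => φ j (l i)).det *
          (Matrix.of fun i j => ψ j (l i)).det * ∏ i, c i (l i) ∂(Measure.pi fun _ => ν)
        = ∑ σ : Equiv.Perm ι, ∑ τ : Equiv.Perm ι, (((σ.sign : ℤ) : 𝕜) * ((τ.sign : ℤ) : 𝕜)) *
            ∏ i, ∫ t, φ (σ i) t * ψ (τ i) t * c i t ∂ν := by
  have hexpand : (fun l : ι → X => (Matrix.of fun i j => φ j (l i)).det *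
        (Matrix.of fun i j => ψ j (l i)).det * ∏ i, c i (l i)) =
      fun l => ∑ σ : Equiv.Perm ι, ∑ τ : Equiv.Perm ι,
        (((σ.sign : ℤ) : 𝕜) * ((τ.sign : ℤ) : 𝕜)) *
          ∏ i, φ (σ i) (l i) * ψ (τ i) (l i) * c i (l i) := by
    funext l
    rw [← Matrix.det_transpose, ← Matrix.det_transpose (Matrix.of fun i j => ψ j (l i)),
      Matrix.det_apply', Matrix.det_apply', Finset.sum_mul_sum, Finset.sum_mul]
    refine Finset.sum_congr rfl fun σ _ => ?_
    rw [Finset.sum_mul]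
    refine Finset.sum_congr rfl fun τ _ => ?_
    simp only [Finset.prod_mul_distrib, Matrix.transpose_apply, Matrix.of_apply]
    ring
  have hterm (σ τ : Equiv.Perm ι) : Integrable (fun l : ι → X =>
      (((σ.sign : ℤ) : 𝕜) * ((τ.sign : ℤ) : 𝕜)) *
        ∏ i, φ (σ i) (l i) * ψ (τ i) (l i) * c i (l i)) (Measure.pi fun _ => ν) :=
    (Integrable.fintype_prod fun i => hint (σ i) (τ i) i).const_mul _
  have hsum (σ : Equiv.Perm ι) := integrable_finsetSum Finset.univ fun τ _ => hterm σ τ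
  rw [hexpand]
  refine ⟨integrable_finsetSum _ fun σ _ => hsum σ, ?_⟩
  rw [integral_finsetSum _ fun σ _ => hsum σ]
  refine Finset.sum_congr rfl fun σ _ => ?_
  rw [integral_finsetSum _ fun τ _ => hterm σ τ]
  refine Finset.sum_congr rfl fun τ _ => ?_
  rw [integral_const_mul, integral_fintype_prod_eq_prod (ι := ι) fun i t =>
    φ (σ i) t * ψ (τ i) t * c i t]

variable {p : ι → X → 𝕜} {w g : X → 𝕜} {h : ι → 𝕜}
  (hint : ∀ i j, Integrable (fun t => p i t * p j t * w t) ν)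
  (hintg : ∀ i j, Integrable (fun t => p i t * p j t * (w t * g t)) ν)
  (horth : ∀ i j, ∫ t, p i t * p j t * w t ∂ν = if i = j then h i else 0)

include hint hintg horth

theorem integral_det_sq_mul_prod_mul_apply (m : ι) :
    Integrable (fun l : ι → X =>
        (Matrix.of fun i j => p j (l i)).det ^ 2 * (∏ i, w (l i)) * g (l m))
        (Measure.pi fun _ => ν) ∧
      ∫ l : ι → X, (Matrix.of fun i j => p j (l i)).det ^ 2 * (∏ i, w (l i)) * g (l m)
          ∂(Measure.pi fun _ => ν)
        = ∑ σ : Equiv.Perm ι, (∏ i ∈ Finset.univ.erase (σ m), h i) *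
            ∫ t, p (σ m) t * p (σ m) t * (w t * g t) ∂ν := by
  have hA := integral_det_mul_det_mul_prod (φ := p) (ψ := p)
    (c := fun i t => w t * if i = m then g t else 1) fun i j k => by
      split_ifs
      exacts [hintg i j, by simpa only [mul_one] using hint i j]
  simp only [Finset.prod_mul_distrib, Finset.prod_ite_eq', Finset.mem_univ, if_true, ← sq,
    ← mul_assoc (_ ^ 2)] at hA
  have hsplit (σ τ : Equiv.Perm ι) :
      ∏ i, ∫ t, p (σ i) t * p (τ i) t * (w t * if i = m then g t else 1) ∂ν
        = (∫ t, p (σ m) t * p (τ m) t * (w t * g t) ∂ν) *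
          ∏ i ∈ Finset.univ.erase m, if σ i = τ i then h (σ i) else 0 := by
    rw [← Finset.mul_prod_erase _ _ (Finset.mem_univ m)]
    simp only [if_true]
    refine congrArg _ (Finset.prod_congr rfl fun i hi => ?_)
    simp only [Finset.ne_of_mem_erase hi, if_false, mul_one, horth]
  refine ⟨hA.1, hA.2.trans (Finset.sum_congr rfl fun σ _ => ?_)⟩
  rw [Finset.sum_eq_single σ (fun τ _ hτ => ?_) (by simp), hsplit]
  · have hsign : ((σ.sign : ℤ) : 𝕜) * ((σ.sign : ℤ) : 𝕜) = 1 := by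
      rcases Int.units_eq_one_or σ.sign with hs | hs <;> simp [hs]
    rw [hsign, one_mul, mul_comm]
    congr 1
    exact Finset.prod_equiv σ (by simp) (by simp)
  · obtain ⟨i, him, hi⟩ := exists_ne_and_perm_apply_ne hτ.symm m
    rw [hsplit, Finset.prod_eq_zero (i := i) (by simp [him]) (if_neg hi), mul_zero, mul_zero]

theorem integral_det_sq_mul_prod_mul_sum :
    Integrable (fun l : ι → X =>
        (Matrix.of fun i j => p j (l i)).det ^ 2 * (∏ i, w (l i)) * ∑ m, g (l m))
        (Measure.pi fun _ => ν) ∧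
      ∫ l : ι → X, (Matrix.of fun i j => p j (l i)).det ^ 2 * (∏ i, w (l i)) * ∑ m, g (l m)
          ∂(Measure.pi fun _ => ν)
        = (Fintype.card ι).factorial * ∑ k, (∏ i ∈ Finset.univ.erase k, h i) *
            ∫ t, p k t * p k t * (w t * g t) ∂ν := by
  have hm := integral_det_sq_mul_prod_mul_apply hint hintg horth
  simp only [Finset.mul_sum (Finset.univ : Finset ι) (fun _ => g _)]
  refine ⟨integrable_finsetSum _ fun m _ => (hm m).1, ?_⟩
  rw [integral_finsetSum _ fun m _ => (hm m).1, Finset.sum_congr rfl fun m _ => (hm m).2,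
    Finset.sum_comm]
  have hreindex (σ : Equiv.Perm ι) := Equiv.sum_comp σ fun k =>
    (∏ i ∈ Finset.univ.erase k, h i) * ∫ t, p k t * p k t * (w t * g t) ∂ν
  rw [Finset.sum_congr rfl fun σ _ => hreindex σ]
  simp [Fintype.card_perm]

end DeterminantalIntegrals

section Ensemble

theorem volume_restrict_orthant (N : ℕ) :
    (volume : Measure (Fin N → ℝ)).restrict (orthant N)
      = Measure.pi fun _ => volume.restrict (Ioi (0 : ℝ)) := by
  have hpi : orthant N = Set.univ.pi fun _ => Ici (0 : ℝ) := by
    ext l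
    simp only [orthant, mem_ofPred_eq, Set.mem_pi, mem_univ, mem_Ici, true_implies]
  rw [hpi, volume_pi, Measure.restrict_pi_pi]
  simp only [restrict_Ioi_eq_restrict_Ici]

theorem ofReal_vandermondeProd_sq_eq_det_sq {N : ℕ} {p : ℕ → ℂ[X]}
    (hp : ∀ j, IsMonicOfDegree (p j) j) (l : Fin N → ℝ) :
    (vandermondeProd l : ℂ) ^ 2 = (Matrix.of fun i j : Fin N => (p j).eval (l i : ℂ)).det ^ 2 := by
  rw [← Matrix.det_eval_matrixOfPolynomials_eq_det_vandermonde (fun i => (l i : ℂ))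
    (fun j => p j) (fun j => (hp j).natDegree_eq) (fun j => (hp j).monic),
    Matrix.det_vandermonde, vandermondeProd]
  push_cast
  simp only [← Finset.prod_pow]
  exact Finset.prod_congr rfl fun i _ => Finset.prod_congr rfl fun j _ => by ring

theorem ofReal_eigenDensity (k : ℕ) {N : ℕ} {p : ℕ → ℂ[X]} (hp : ∀ j, IsMonicOfDegree (p j) j)
    (l : Fin N → ℝ) :
    (eigenDensity k N l : ℂ) = (Matrix.of fun i j : Fin N => (p j).eval (l i : ℂ)).det ^ 2 *
      ∏ i, expWeighted N (X ^ k) (l i) := by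
  simp [eigenDensity, expWeighted_apply, ofReal_vandermondeProd_sq_eq_det_sq hp]

theorem ofReal_laguerreNormSq (k : ℕ) (a : ℝ) (j : ℕ) :
    ((laguerreNormSq k a j : ℝ) : ℂ) = laguerreNormSq k (a : ℂ) j := by
  simp [laguerreNormSq]

theorem laguerreNormSq_pos (k : ℕ) {a : ℝ} (ha : 0 < a) (j : ℕ) : 0 < laguerreNormSq k a j := by
  unfold laguerreNormSq
  positivity

theorem integrableOn_expWeighted_mul {n : ℂ} (hn : 0 < n.re) (f : ℂ[X]) {g : ℝ → ℂ}
    (hg : Measurable g) {B : ℝ} (hB : ∀ t, 0 ≤ t → ‖g t‖ ≤ B) :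
    IntegrableOn (fun t => expWeighted n f t * g t) (Ioi 0) := by
  refine (integrableOn_expWeighted hn f).mul_bdd (c := B) hg.aestronglyMeasurable ?_
  filter_upwards [ae_restrict_mem measurableSet_Ioi] with t ht using hB t (le_of_lt ht)

theorem integral_densityPoly_mul {n : ℂ} (k : ℕ) {N : ℕ} (hN : N ≠ 0) {g : ℝ → ℂ}
    (hg : ∀ f, IntegrableOn (fun t => expWeighted n f t * g t) (Ioi 0)) :
    N * ∫ t in Ioi (0 : ℝ), expWeighted n (densityPoly k n N) t * g t
      = ∑ j : Fin N, (laguerreNormSq k n⁻¹ j)⁻¹ * ∫ t in Ioi (0 : ℝ), expWeighted n (X ^ k *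
          (monicLaguerre (k : ℂ) n⁻¹ j * monicLaguerre (k : ℂ) n⁻¹ j)) t * g t := by
  have hN0 : (N : ℂ) ≠ 0 := Nat.cast_ne_zero.mpr hN
  simp only [densityPoly, map_smul, Pi.smul_apply, smul_eq_mul, mul_assoc (N : ℂ)⁻¹,
    integral_const_mul, mul_inv_cancel_left₀ hN0]
  simp only [Finset.mul_sum, mul_smul_comm, map_sum, map_smul, Finset.sum_apply, Pi.smul_apply,
    smul_eq_mul, Finset.sum_mul, mul_assoc (_⁻¹ : ℂ)]
  rw [integral_finsetSum _ fun j _ => (hg _).const_mul _, ← Fin.sum_univ_eq_sum_range]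
  simp only [integral_const_mul]

variable (k : ℕ) {N : ℕ} (hN : N ≠ 0)
include hN

theorem integral_eigenDensity_mul_sum {g : ℝ → ℂ} (hg : Measurable g) {B : ℝ}
    (hB : ∀ t, 0 ≤ t → ‖g t‖ ≤ B) :
    IntegrableOn (fun l : Fin N → ℝ => (eigenDensity k N l : ℂ) * ∑ m, g (l m)) (orthant N) ∧
      ∫ l in orthant N, (eigenDensity k N l : ℂ) * ∑ m, g (l m)
        = N.factorial * (∏ i : Fin N, laguerreNormSq k (N : ℂ)⁻¹ i) *
          (N * ∫ t in Ioi (0 : ℝ), expWeighted N (densityPoly k (N : ℂ) N) t * g t) := by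
  have hN0 : (N : ℂ) ≠ 0 := Nat.cast_ne_zero.mpr hN
  have hn : 0 < (N : ℂ).re := by simpa using Nat.pos_of_ne_zero hN
  have hgint f := integrableOn_expWeighted_mul hn f hg hB
  set p := monicLaguerre (k : ℂ) (N : ℂ)⁻¹
  have hpw (i j : ℕ) (t : ℝ) : (p i).eval (t : ℂ) * (p j).eval (t : ℂ) * expWeighted N (X ^ k) t
      = expWeighted N (X ^ k * (p i * p j)) t := by
    simp only [expWeighted_apply, eval_mul]
    ring
  have hpwg (i j : ℕ) (t : ℝ) :
      (p i).eval (t : ℂ) * (p j).eval (t : ℂ) * (expWeighted N (X ^ k) t * g t)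
        = expWeighted N (X ^ k * (p i * p j)) t * g t := by rw [← mul_assoc, hpw]
  have handreief := integral_det_sq_mul_prod_mul_sum (ν := volume.restrict (Ioi (0 : ℝ)))
    (p := fun (j : Fin N) t => (p j).eval (t : ℂ)) (w := expWeighted N (X ^ k)) (g := g)
    (h := fun j => laguerreNormSq k (N : ℂ)⁻¹ j)
    (fun i j => by simp only [hpw]; exact integrableOn_expWeighted hn _)
    (fun i j => by simp only [hpwg]; exact hgint _)
    (fun i j => by
      simp only [hpw, Fin.ext_iff]
      exact expMoment_monicLaguerre_mul hn (mul_inv_cancel₀ hN0) k i j)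
  have hdet := ofReal_eigenDensity k (N := N) (p := p) (isMonicOfDegree_monicLaguerre _ _)
  simp only [← volume_restrict_orthant, ← hdet, hpwg, Fintype.card_fin] at handreief
  refine ⟨handreief.1, handreief.2.trans ?_⟩
  rw [integral_densityPoly_mul k hN hgint, mul_assoc, Finset.mul_sum _ _ (∏ i, _)]
  congr 1
  refine Finset.sum_congr rfl fun j _ => ?_
  rw [← Finset.prod_erase_mul _ _ (Finset.mem_univ j), mul_assoc,
    mul_inv_cancel_left₀ (laguerreNormSq_ne_zero k (inv_ne_zero hN0) (j : ℕ))]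

theorem integral_eigenDensity :
    IntegrableOn (eigenDensity k N) (orthant N) ∧
      partitionFn k N = N.factorial * ∏ i : Fin N, laguerreNormSq k (N : ℝ)⁻¹ i := by
  have hN0 : (N : ℂ) ≠ 0 := Nat.cast_ne_zero.mpr hN
  have hn : 0 < (N : ℂ).re := by simpa using Nat.pos_of_ne_zero hN
  obtain ⟨hint, hval⟩ := integral_eigenDensity_mul_sum k hN (g := fun _ => 1) measurable_const
    (B := 1) (by simp)
  simp only [Finset.sum_const, Finset.card_univ, Fintype.card_fin, nsmul_eq_mul, mul_one]
    at hint hval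
  constructor
  · simpa [IntegrableOn, mul_assoc, hN0] using (hint.mul_const (N : ℂ)⁻¹).re
  · rw [← expMoment_apply hn, expMoment_densityPoly hn k hN, integral_mul_const,
      integral_complex_ofReal, mul_one] at hval
    apply Complex.ofReal_injective
    push_cast [ofReal_laguerreNormSq]
    exact mul_right_cancel₀ hN0 hval

theorem partitionFn_pos : 0 < partitionFn k N := by
  rw [(integral_eigenDensity k hN).2]
  exact mul_pos (by positivity) (Finset.prod_pos fun i _ => laguerreNormSq_pos k (by positivity) i)

variable {x : ℂ} (hx : x ∈ offCut)
include hx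

theorem oneLoopMean_eq_stieltjes :
    IntegrableOn (resolventIntegrand k N x) (orthant N) ∧
      oneLoopMean k N x = stieltjes (expWeighted N (densityPoly k (N : ℂ) N)) x := by
  obtain ⟨B, hB⟩ := exists_norm_inv_sub_le hx
  obtain ⟨hint, hval⟩ := integral_eigenDensity_mul_sum k hN (g := fun t : ℝ => (x - t)⁻¹)
    (by fun_prop) hB
  refine ⟨by unfold resolventIntegrand; simpa only [one_div] using hint, ?_⟩
  have hN0 : (N : ℂ) ≠ 0 := Nat.cast_ne_zero.mpr hN
  have hZ : (partitionFn k N : ℂ) ≠ 0 := Complex.ofReal_ne_zero.mpr (partitionFn_pos k hN).ne'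
  have hZval : (partitionFn k N : ℂ)
      = N.factorial * ∏ i : Fin N, laguerreNormSq k (N : ℂ)⁻¹ i := by
    rw [(integral_eigenDensity k hN).2]
    push_cast [ofReal_laguerreNormSq]
    rfl
  simp only [oneLoopMean, resolventIntegrand, one_div, hval, ← hZval, stieltjes]
  field_simp

end Ensemble

section LoopEquation

theorem stieltjes_densityPoly_equation {n : ℂ} (hn : 0 < n.re) (k : ℕ) {N : ℕ} (hN : N ≠ 0)
    {W : ℂ → ℂ} (hW : W = stieltjes (expWeighted n (densityPoly k n N))) {x : ℂ}
    (hx : x ∈ offCut) :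
    x ^ 3 * iteratedDeriv 3 W x + 4 * x ^ 2 * iteratedDeriv 2 W x
      + ((2 - (k : ℂ) ^ 2) * x + 2 * n * (2 * N + k) * x ^ 2 - n ^ 2 * x ^ 3) * iteratedDeriv 1 W x
      + (n * (2 * N + k) * x - (k : ℂ) ^ 2) * W x = n ^ 2 * x + n * k := by
  have hdiff : DifferentiableOn ℂ W offCut :=
    hW ▸ differentiableOn_stieltjes (integrableOn_expWeighted hn _)
  obtain ⟨h₁, h₂, h₃⟩ := eqOn_iterate_hasDerivAt_mul isOpen_offCut hdiff
    (fun _ hy => hW ▸ hasDerivAt_mul_stieltjes_expWeighted hn hy _)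
    (fun _ hy => hasDerivAt_mul_stieltjes_expWeighted hn hy _)
    (fun _ hy => hasDerivAt_mul_stieltjes_expWeighted hn hy _)
  have hS := expStieltjes_densityPoly_equation hn hx k hN rfl
  simp only [expStieltjes_apply, h₁ hx, h₂ hx, h₃ hx, ← hW] at hS
  linear_combination hS

/-- For `W` solving the third-order equation `P = 0`, the fourth-order expression multiplied by `x`
is `(ν⁻² ∂ + 2 + ν⁻¹) P`. -/
theorem fourth_order_of_third_order {s : Set ℂ} (hs : IsOpen s) {W : ℂ → ℂ}
    (hW : DifferentiableOn ℂ W s) {ν : ℂ} (hν : ν ≠ 0)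
    (hode : ∀ x ∈ s, x ^ 3 * iteratedDeriv 3 W x + 4 * x ^ 2 * iteratedDeriv 2 W x
      + (x + 2 * ν * (2 * ν + 1) * x ^ 2 - ν ^ 2 * x ^ 3) * iteratedDeriv 1 W x
      + (ν * (2 * ν + 1) * x - 1) * iteratedDeriv 0 W x = ν ^ 2 * x + ν)
    {x : ℂ} (hx : x ∈ s) (hx0 : x ≠ 0) :
    ν ^ 2 * ((-2 * x ^ 2 + 8 * x) * iteratedDeriv 1 W x + 4 * iteratedDeriv 0 W x)
      + ν * ((-x ^ 2 + 8 * x) * iteratedDeriv 1 W x + 4 * iteratedDeriv 0 W x)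
      + (2 * x ^ 2 * iteratedDeriv 3 W x + (-x ^ 2 + 12 * x) * iteratedDeriv 2 W x
        + (-x + 12) * iteratedDeriv 1 W x + iteratedDeriv 0 W x)
      + ν⁻¹ * (x ^ 2 * iteratedDeriv 3 W x + 6 * x * iteratedDeriv 2 W x
        + 6 * iteratedDeriv 1 W x)
      + (ν ^ 2)⁻¹ * (x ^ 2 * iteratedDeriv 4 W x + 7 * x * iteratedDeriv 3 W x
        + 9 * iteratedDeriv 2 W x)
    = 2 * ν ^ 2 + ν + (2 * ν + 2) / x := by
  have hD (m : ℕ) := hasDerivAt_iteratedDeriv hs hW m hx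
  have hpow (m : ℕ) (c : ℂ) := (hasDerivAt_pow m x).const_mul c
  have hlhs := (((hpow 3 1).mul (hD 3)).add ((hpow 2 4).mul (hD 2))).add
    (((((hpow 1 1).add (hpow 2 (2 * ν * (2 * ν + 1)))).sub (hpow 3 (ν ^ 2))).mul (hD 1)).add
      (((hpow 1 (ν * (2 * ν + 1))).sub_const 1).mul (hD 0)))
  have hrhs := ((hpow 1 (ν ^ 2)).add_const ν).congr_of_eventuallyEq (by
    filter_upwards [hs.mem_nhds hx] with y hy
    rw [pow_one, ← hode y hy])
  have hderiv : x ^ 3 * iteratedDeriv 4 W x + 7 * x ^ 2 * iteratedDeriv 3 W x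
      + (9 * x + 2 * ν * (2 * ν + 1) * x ^ 2 - ν ^ 2 * x ^ 3) * iteratedDeriv 2 W x
      + (5 * ν * (2 * ν + 1) * x - 3 * ν ^ 2 * x ^ 2) * iteratedDeriv 1 W x
      + ν * (2 * ν + 1) * iteratedDeriv 0 W x = ν ^ 2 := by
    have h := (hlhs.congr_of_eventuallyEq (.of_forall fun y => ?_)).unique hrhs
    · simp only [Pi.add_apply, Pi.sub_apply] at h
      norm_num only at h
      linear_combination h
    · simp only [Pi.add_apply, Pi.sub_apply, Pi.mul_apply]
      ring
  have hode := hode x hx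
  field_simp
  linear_combination hderiv + (2 * ν ^ 2 + ν) * hode

end LoopEquation

end LaguerreLoop

open LaguerreLoop in
theorem mainTheorem6_general (k N : ℕ) (hN : 1 ≤ N) :
    (IntegrableOn (eigenDensity k N) (orthant N) ∧ 0 < partitionFn k N) ∧
    (∀ x ∈ offCut, IntegrableOn (resolventIntegrand k N x) (orthant N)) ∧
    DifferentiableOn ℂ (oneLoopMean k N) offCut ∧
    ∀ x ∈ offCut, ∀ W : ℕ → ℂ, (∀ n, W n = iteratedDeriv n (oneLoopMean k N) x) →
      x ^ 3 * W 3 + 4 * x ^ 2 * W 2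
        + ((2 - (k : ℂ) ^ 2) * x + 2 * N * (2 * N + k) * x ^ 2 - (N : ℂ) ^ 2 * x ^ 3) * W 1
        + (N * (2 * N + k) * x - (k : ℂ) ^ 2) * W 0
      = (N : ℂ) ^ 2 * x + N * k := by
  have hN0 : N ≠ 0 := Nat.one_le_iff_ne_zero.mp hN
  have hn : 0 < (N : ℂ).re := by simpa using hN0.bot_lt
  have hmean : EqOn (oneLoopMean k N) (stieltjes (expWeighted N (densityPoly k (N : ℂ) N)))
      offCut := fun x hx => (oneLoopMean_eq_stieltjes k hN0 hx).2
  refine ⟨⟨(integral_eigenDensity k hN0).1, partitionFn_pos k hN0⟩,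
    fun x hx => (oneLoopMean_eq_stieltjes k hN0 hx).1,
    (differentiableOn_stieltjes (integrableOn_expWeighted hn _)).congr hmean,
    fun x hx W hW => ?_⟩
  simp only [hW, hmean.iteratedDeriv_of_isOpen isOpen_offCut _ hx, iteratedDeriv_zero]
  exact stieltjes_densityPoly_equation hn k hN0 rfl hx

theorem mainTheorem6 (N : ℕ) (hN : 1 ≤ N) :
    (IntegrableOn (LaguerreLoop.eigenDensity 1 N) (LaguerreLoop.orthant N) ∧
      0 < LaguerreLoop.partitionFn 1 N) ∧
    (∀ x ∈ LaguerreLoop.offCut,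
      IntegrableOn (LaguerreLoop.resolventIntegrand 1 N x) (LaguerreLoop.orthant N)) ∧
    DifferentiableOn ℂ (LaguerreLoop.oneLoopMean 1 N) LaguerreLoop.offCut ∧
    ∀ x ∈ LaguerreLoop.offCut, ∀ W : ℕ → ℂ,
      (∀ n, W n = iteratedDeriv n (LaguerreLoop.oneLoopMean 1 N) x) →
      (N : ℂ) ^ 2 * ((-2 * x ^ 2 + 8 * x) * W 1 + 4 * W 0)
        + (N : ℂ) * ((-x ^ 2 + 8 * x) * W 1 + 4 * W 0)
        + (2 * x ^ 2 * W 3 + (-x ^ 2 + 12 * x) * W 2 + (-x + 12) * W 1 + W 0)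
        + (N : ℂ)⁻¹ * (x ^ 2 * W 3 + 6 * x * W 2 + 6 * W 1)
        + ((N : ℂ) ^ 2)⁻¹ * (x ^ 2 * W 4 + 7 * x * W 3 + 9 * W 2)
      = 2 * (N : ℂ) ^ 2 + (N : ℂ) + (2 * (N : ℂ) + 2) / x := by
  obtain ⟨hZ, hint, hdiff, hode⟩ := mainTheorem6_general 1 N hN
  refine ⟨hZ, hint, hdiff, fun x hx W hW => ?_⟩
  simp only [hW]
  exact LaguerreLoop.fourth_order_of_third_order LaguerreLoop.isOpen_offCut hdiff
    (Nat.cast_ne_zero.mpr (Nat.one_le_iff_ne_zero.mp hN))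
    (fun y hy => by linear_combination hode y hy _ fun _ => rfl) hx (by simpa using hx 0 le_rfl)
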